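/- Let $n\ge 3$ and $\phi=X^n+XY^2+Z^2\in\mathbb C[X,Y,Z]$. Grade $\mathbb C[X,Y,Z]$ by $\deg X=4$, $\deg Y=2n-2$, $\deg Z=2n$, and equip it with the Poisson bracket $\{\cdot,\cdot\}_\phi$, of degree $-2$, determined by $\{X,Y\}_\phi=\partial\phi/\partial Z$, $\{X,Z\}_\phi=-\partial\phi/\partial Y$, $\{Y,Z\}_\phi=\partial\phi/\partial X$. A noncommutative deformation of $(\mathbb C[X,Y,Z],\{\cdot,\cdot\}_\phi)$ is an associative unital $\mathbb C$-algebra $A$ with an exhaustive algebra filtration $A_0\subseteq A_1\subseteq A_2\subseteq\cdots$ and an isomorphism of graded algebras $\operatorname{gr}A=\bigoplus_i A_i/A_{i-1}\cong\mathbb C[X,Y,Z]$ (with $A_{-1}=0$) such that, for $a\in A_i$ and $b\in A_j$ with $i+j\ge 2$, one has $[a,b]=ab-ba\in A_{i+j-2}$, and the class of $[a,b]$ in degree $i+j-2$ corresponds to $\{\bar a,\bar b\}_\phi$, where $\bar a,\bar b\in\mathbb C[X,Y,Z]$ correspond to the classes of $a$ and $b$ in degrees $i$ and $j$. For $P\in\mathbb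 C[t]$ of degree $n-1$ and $\gamma\in\mathbb C$, let $H(P,\gamma)$ be the associative $\mathbb C$-algebra with generators $U,V,W$ and relations $$[U,V]=2W,\qquad [U,W]=-2UV+2W+\gamma,\qquad [V,W]=V^2+P(U),$$ filtered so that degree $\le d$ is spanned by the monomials $U^iV^jW^k$ with $4i+(2n-2)j+2nk\le d$. Lemma. Let $A$ be a noncommutative deformation of $(\mathbb C[X,Y,Z],\{\cdot,\cdot\}_\phi)$. Then there are a polynomial $P(t)=nt^{n-1}+(\text{lower terms})\in\mathbb C[t]$ and $\gamma\in\mathbb C$ such that $A$ is isomorphic to $H(P,\gamma)$ as a filtered algebra, that is, by an algebra isomorphism that maps $A_d$ onto the degree $\le d$ part of $H(P,\gamma)$ for every $d\ge 0$. -/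

import Mathlib

open MvPolynomial in
/-- The bracket `{f, g}_φ` on `ℂ[X, Y, Z]` (with `X = X 0`, `Y = X 1`, `Z = X 2`): the unique
biderivation with `{X, Y}_φ = ∂φ/∂Z`, `{X, Z}_φ = -∂φ/∂Y`, `{Y, Z}_φ = ∂φ/∂X`. -/
noncomputable def poissonBracket (φ f g : MvPolynomial (Fin 3) ℂ) : MvPolynomial (Fin 3) ℂ :=
  (pderiv 0 f * pderiv 1 g - pderiv 1 f * pderiv 0 g) * pderiv 2 φ
    - (pderiv 0 f * pderiv 2 g - pderiv 2 f * pderiv 0 g) * pderiv 1 φ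
    + (pderiv 1 f * pderiv 2 g - pderiv 2 f * pderiv 1 g) * pderiv 0 φ

open MvPolynomial in
/-- `φ = X ^ n + X Y ^ 2 + Z ^ 2`. -/
noncomputable def typeDPoly (n : ℕ) : MvPolynomial (Fin 3) ℂ :=
  X 0 ^ n + X 0 * X 1 ^ 2 + X 2 ^ 2

/-- The degrees of `X`, `Y`, `Z`, for which `φ` is homogeneous of degree `4 n` and
`{·, ·}_φ` has degree `-2`. -/
def typeDWeight (n : ℕ) : Fin 3 → ℕ := ![4, 2 * n - 2, 2 * n]

section Graded

variable {A : Type*} [Ring A] [Algebra ℂ A]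

/-- The part `∑_{j < i} F j` of a filtration below index `i` (zero for `i = 0`). -/
def filtLT (F : ℕ → Submodule ℂ A) (i : ℕ) : Submodule ℂ A := ⨆ j, ⨆ _ : j < i, F j

/-- The component of degree `i` of the associated graded algebra. -/
abbrev GrPiece (F : ℕ → Submodule ℂ A) (i : ℕ) : Type _ :=
  F i ⧸ (filtLT F i).submoduleOf (F i)

/-- The class in degree `i` of the associated graded algebra of an element of `F i`. -/
def grClass (F : ℕ → Submodule ℂ A) (i : ℕ) : F i →ₗ[ℂ] GrPiece F i :=
  ((filtLT F i).submoduleOf (F i)).mkQ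

end Graded

/-- A noncommutative deformation structure on the associative algebra `A`: an exhaustive algebra
filtration `A_0 ⊆ A_1 ⊆ ⋯` together with an isomorphism of graded algebras
`gr A ≅ ℂ[X, Y, Z]` (where `X`, `Y`, `Z` have degrees `4`, `2 n - 2`, `2 n`), under which the
bracket on `gr A` that commutators in `A` induce is `{·, ·}_φ`, for `φ = X ^ n + X Y ^ 2 + Z ^ 2`. -/
structure NoncommDeformation (n : ℕ) (A : Type*) [Ring A] [Algebra ℂ A] where
  /-- the filtration -/
  filt : ℕ → Submodule ℂ A
  isRingFiltration : IsRingFiltration filt (filtLT filt)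
  exhaustive : ∀ a : A, ∃ i, a ∈ filt i
  /-- the isomorphism `gr A ≅ ℂ[X, Y, Z]`, degree by degree -/
  grEquiv : ∀ i, GrPiece filt i ≃ₗ[ℂ]
    MvPolynomial.weightedHomogeneousSubmodule ℂ (typeDWeight n) i
  grEquiv_one :
    (grEquiv 0 (grClass filt 0 ⟨1, isRingFiltration.one_mem⟩) : MvPolynomial (Fin 3) ℂ) = 1
  grEquiv_mul : ∀ (i j : ℕ) (a : filt i) (b : filt j),
    (grEquiv (i + j) (grClass filt (i + j)
        ⟨(a : A) * b, isRingFiltration.mul_mem a.2 b.2⟩) : MvPolynomial (Fin 3) ℂ)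
      = grEquiv i (grClass filt i a) * grEquiv j (grClass filt j b)
  /-- `[A_i, A_j] ⊆ A_{i + j - 2}` and `gr [a, b] = {gr a, gr b}_φ`. -/
  grEquiv_commutator : ∀ (i j k : ℕ), i + j = k + 2 → ∀ (a : filt i) (b : filt j),
    ∃ h : (a : A) * b - b * a ∈ filt k,
      (grEquiv k (grClass filt k ⟨(a : A) * b - b * a, h⟩) : MvPolynomial (Fin 3) ℂ)
        = poissonBracket (typeDPoly n)
            (grEquiv i (grClass filt i a)) (grEquiv j (grClass filt j b))

open FreeAlgebra in
/-- The defining relations of `H(P, γ)` on `U = ι 0`, `V = ι 1`, `W = ι 2`: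
`[U, V] = 2 W`, `[U, W] = -2 U V + 2 W + γ`, `[V, W] = V ^ 2 + P(U)`. -/
inductive HRel (P : Polynomial ℂ) (γ : ℂ) :
    FreeAlgebra ℂ (Fin 3) → FreeAlgebra ℂ (Fin 3) → Prop
  | uv : HRel P γ (ι ℂ 0 * ι ℂ 1 - ι ℂ 1 * ι ℂ 0) (2 * ι ℂ 2)
  | uw : HRel P γ (ι ℂ 0 * ι ℂ 2 - ι ℂ 2 * ι ℂ 0)
      (-2 * (ι ℂ 0 * ι ℂ 1) + 2 * ι ℂ 2 + algebraMap ℂ _ γ)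
  | vw : HRel P γ (ι ℂ 1 * ι ℂ 2 - ι ℂ 2 * ι ℂ 1)
      (ι ℂ 1 ^ 2 + Polynomial.aeval (ι ℂ 0) P)

/-- The algebra `H(P, γ)`. -/
abbrev HAlg (P : Polynomial ℂ) (γ : ℂ) : Type := RingQuot (HRel P γ)

/-- The generators `U`, `V`, `W` of `H(P, γ)`, for the indices `0`, `1`, `2`. -/
noncomputable def HAlg.gen (P : Polynomial ℂ) (γ : ℂ) (i : Fin 3) : HAlg P γ :=
  RingQuot.mkAlgHom ℂ (HRel P γ) (FreeAlgebra.ι ℂ i)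

/-- The filtration of `H(P, γ)` with `U`, `V`, `W` in degrees `4`, `2 n - 2`, `2 n`: degree `d` is
spanned by the monomials `U ^ i V ^ j W ^ k` with `4 i + (2 n - 2) j + 2 n k ≤ d`. -/
noncomputable def HAlg.filt (n : ℕ) (P : Polynomial ℂ) (γ : ℂ) (d : ℕ) :
    Submodule ℂ (HAlg P γ) :=
  Submodule.span ℂ {x | ∃ i j k : ℕ, 4 * i + (2 * n - 2) * j + 2 * n * k ≤ d ∧
    x = HAlg.gen P γ 0 ^ i * HAlg.gen P γ 1 ^ j * HAlg.gen P γ 2 ^ k}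

/-!
Commutators of lifts `u`, `v`, `w` of `X`, `Y`, `Z` have smaller degree than the corresponding
products, so products can be straightened, and the ordered monomials `u ^ i * v ^ j * w ^ k` form a
basis of `A` adapted to the filtration. For degree reasons the brackets `[u, w]` and `[v, w]` agree
with those of `H(P, γ)` up to few lower terms. Replacing `u` by `u - b` and `v` by `v - s(u)`, which
changes no symbols, removes the lower terms of `[u, w]` except for a multiple of `w` and a constant.
The Jacobi identity for `u`, `v`, `w`, expanded in ordered monomials, forces that multiple of `w` to
be `2 w` and removes the terms of `[v, w]` that involve `w` or are linear in `v`. The resulting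
homomorphism `H(P, γ) → A` is bijective because the ordered monomials in `U`, `V`, `W` span
`H(P, γ)` and their images form a basis of `A`.
-/

open MvPolynomial Finsupp

attribute [local instance] LieRing.ofAssociativeRing

section OrderedMonomial

variable {σ M N : Type*} [LinearOrder σ] [Monoid M] [Monoid N]

/-- The ordered monomial `∏ i, x i ^ m i` in a noncommutative monoid: the factors are multiplied in
increasing order of `i`. -/
def orderedMonomial (x : σ → M) (m : σ →₀ ℕ) : M :=
  (m.support.sort.map fun i => x i ^ m i).prod

@[simp]
theorem orderedMonomial_zero (x : σ → M) : orderedMonomial x 0 = 1 := by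
  simp [orderedMonomial]

theorem orderedMonomial_eq_pow_mul_erase (x : σ → M) {i : σ} {m : σ →₀ ℕ}
    (hi : ∀ j ∈ m.support, i ≤ j) :
    orderedMonomial x m = x i ^ m i * orderedMonomial x (m.erase i) := by
  by_cases him : i ∈ m.support
  · have hsort : m.support.sort = i :: (m.support.erase i).sort := by
      conv_lhs => rw [← Finset.insert_erase him]
      exact Finset.sort_insert _ (fun j hj => hi j (Finset.mem_of_mem_erase hj))
        (Finset.notMem_erase i _)
    rw [orderedMonomial, hsort, List.map_cons, List.prod_cons, orderedMonomial, support_erase]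
    congr 2
    refine List.map_congr_left fun j hj => ?_
    rw [erase_ne (Finset.ne_of_mem_erase ((Finset.mem_sort _).1 hj))]
  · rw [notMem_support_iff.1 him, erase_of_notMem_support him, pow_zero, one_mul]

theorem le_of_mem_support_single_add {i j : σ} {m : σ →₀ ℕ} (hi : ∀ k ∈ m.support, i ≤ k)
    (hj : j ∈ (single i 1 + m).support) : i ≤ j := by
  rcases eq_or_ne i j with rfl | hij
  · exact le_rfl
  · exact hi j (by simpa [single_eq_of_ne hij.symm] using hj)

theorem orderedMonomial_single_add (x : σ → M) {i : σ} {m : σ →₀ ℕ}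
    (hi : ∀ j ∈ m.support, i ≤ j) :
    orderedMonomial x (single i 1 + m) = x i * orderedMonomial x m := by
  rw [orderedMonomial_eq_pow_mul_erase x fun j => le_of_mem_support_single_add hi,
    orderedMonomial_eq_pow_mul_erase x hi, erase_add,
    erase_single, zero_add, Finsupp.add_apply, single_eq_same, pow_add, pow_one, mul_assoc]

theorem orderedMonomial_single (x : σ → M) (i : σ) : orderedMonomial x (single i 1) = x i := by
  simpa using orderedMonomial_single_add x (i := i) (m := 0) (by simp)

theorem map_orderedMonomial {F : Type*} [FunLike F M N] [MonoidHomClass F M N] (f : F) (x : σ → M)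
    (m : σ →₀ ℕ) : f (orderedMonomial x m) = orderedMonomial (f ∘ x) m := by
  simp [orderedMonomial, map_list_prod, Function.comp_def]

theorem orderedMonomial_fin_three (x : Fin 3 → M) (m : Fin 3 →₀ ℕ) :
    orderedMonomial x m = x 0 ^ m 0 * x 1 ^ m 1 * x 2 ^ m 2 := by
  have herase : ((m.erase 0).erase 1).erase 2 = 0 := by
    ext i; fin_cases i <;> simp
  rw [orderedMonomial_eq_pow_mul_erase x (i := 0) fun j _ => Fin.zero_le j,
    orderedMonomial_eq_pow_mul_erase x (i := 1) (by simp [Fin.forall_fin_succ]),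
    orderedMonomial_eq_pow_mul_erase x (i := 2) (by simp [Fin.forall_fin_succ]), herase]
  simp [mul_assoc]

theorem exists_single_add_of_ne_zero {m : σ →₀ ℕ} (hm : m ≠ 0) :
    ∃ i m', m = single i 1 + m' ∧ ∀ j ∈ m'.support, i ≤ j := by
  have hne : m.support.Nonempty := support_nonempty_iff.2 hm
  refine ⟨m.support.min' hne, m - single (m.support.min' hne) 1, ?_,
    fun j hj => m.support.min'_le j (support_tsub hj)⟩
  rw [add_tsub_cancel_of_le]
  exact single_le_iff.2 (Nat.one_le_iff_ne_zero.2 (mem_support_iff.1 (m.support.min'_mem hne)))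

end OrderedMonomial

section OrderedSpan

variable {σ R B C : Type*} [LinearOrder σ] [CommRing R] [Ring B] [Algebra R B] [Ring C]
  [Algebra R C]

variable (R) in
/-- The span of the ordered monomials in `x` of weight at most `d`, where `x i` has weight `w i`. -/
def orderedSpan (w : σ → ℕ) (x : σ → B) (d : ℕ) : Submodule R B :=
  Submodule.span R (orderedMonomial x '' {m | weight w m ≤ d})

variable {w : σ → ℕ} {x : σ → B} {d e : ℕ}

theorem orderedMonomial_mem_orderedSpan {m : σ →₀ ℕ} (hm : weight w m ≤ d) :
    orderedMonomial x m ∈ orderedSpan R w x d :=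
  Submodule.subset_span ⟨m, hm, rfl⟩

theorem mem_orderedSpan_self (i : σ) : x i ∈ orderedSpan R w x (w i) := by
  rw [← orderedMonomial_single x i]
  exact orderedMonomial_mem_orderedSpan (by simp [weight_single])

theorem one_mem_orderedSpan : (1 : B) ∈ orderedSpan R w x d := by
  rw [← orderedMonomial_zero x]
  exact orderedMonomial_mem_orderedSpan (by simp)

theorem orderedSpan_mono (h : d ≤ e) : orderedSpan R w x d ≤ orderedSpan R w x e :=
  Submodule.span_mono (Set.image_mono fun _ hm => le_trans hm h)

theorem map_orderedSpan (f : B →ₐ[R] C) (w : σ → ℕ) (x : σ → B) (d : ℕ) :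
    (orderedSpan R w x d).map f.toLinearMap = orderedSpan R w (f ∘ x) d := by
  rw [orderedSpan, Submodule.map_span, Set.image_image, orderedSpan]
  simp only [AlgHom.toLinearMap_apply, map_orderedMonomial]

theorem mul_mem_of_mul_orderedMonomial_mem {y z : B} {S : Submodule R B}
    (h : ∀ m, weight w m ≤ d → y * orderedMonomial x m ∈ S) (hz : z ∈ orderedSpan R w x d) :
    y * z ∈ S := by
  suffices orderedSpan R w x d ≤ S.comap (LinearMap.mulLeft R y) from this hz
  exact Submodule.span_le.2 (Set.image_subset_iff.2 h)

/-- The straightening step: moving `x i` past a smaller `x j` costs the commutator of the two, which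
only contributes to products of smaller total weight. -/
theorem mul_orderedMonomial_mem_orderedSpan [WellFoundedLT σ] (hw : ∀ i, 0 < w i)
    (hx : ∀ i j, i < j → ∃ c < w i + w j, ⁅x j, x i⁆ ∈ orderedSpan R w x c)
    (hmul : ∀ a b, a + b < e →
      orderedSpan R w x a * orderedSpan R w x b ≤ orderedSpan R w x (a + b))
    (i : σ) (m : σ →₀ ℕ) (hm : w i + weight w m ≤ e) :
    x i * orderedMonomial x m ∈ orderedSpan R w x e := by
  induction i using WellFoundedLT.induction generalizing m with
  | _ i ih =>
    by_cases hi : ∀ j ∈ m.support, i ≤ j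
    · rw [← orderedMonomial_single_add x hi]
      exact orderedMonomial_mem_orderedSpan (by simpa [weight_single] using hm)
    have hm0 : m ≠ 0 := by rintro rfl; simp at hi
    obtain ⟨j, m', rfl, hj⟩ := exists_single_add_of_ne_zero hm0
    have hji : j < i := by
      by_contra! hij
      exact hi fun k hk => hij.trans (le_of_mem_support_single_add hj hk)
    obtain ⟨c, hc, hcomm⟩ := hx j i hji
    have hm' : weight w (single j 1 + m') = w j + weight w m' := by simp [weight_single]
    have hwj := hw j
    set y := orderedMonomial x m'
    have hy : y ∈ orderedSpan R w x (weight w m') := orderedMonomial_mem_orderedSpan le_rfl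
    have hswap : x i * (x j * y) = x j * (x i * y) + ⁅x i, x j⁆ * y := by
      rw [Ring.lie_def]; noncomm_ring
    rw [orderedMonomial_single_add x hj, hswap]
    refine add_mem ?_ ?_
    · have hxy : x i * y ∈ orderedSpan R w x (w i + weight w m') :=
        hmul _ _ (by omega) (Submodule.mul_mem_mul (mem_orderedSpan_self i) hy)
      exact mul_mem_of_mul_orderedMonomial_mem (fun k hk => ih j hji k (by omega)) hxy
    · exact orderedSpan_mono (by omega) (hmul _ _ (by omega) (Submodule.mul_mem_mul hcomm hy))

theorem orderedSpan_mul_le [WellFoundedLT σ] (hw : ∀ i, 0 < w i)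
    (hx : ∀ i j, i < j → ∃ c < w i + w j, ⁅x j, x i⁆ ∈ orderedSpan R w x c) (a b : ℕ) :
    orderedSpan R w x a * orderedSpan R w x b ≤ orderedSpan R w x (a + b) := by
  induction he : a + b using Nat.strong_induction_on generalizing a b with
  | _ e ih =>
    have hmul : ∀ a b, a + b < e →
        orderedSpan R w x a * orderedSpan R w x b ≤ orderedSpan R w x (a + b) :=
      fun a b hab => ih _ hab a b rfl
    rw [Submodule.mul_le]
    intro y hy z hz
    suffices orderedSpan R w x a ≤ (orderedSpan R w x e).comap (LinearMap.mulRight R z) from this hy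
    refine Submodule.span_le.2 (Set.image_subset_iff.2 fun m (hm : weight w m ≤ a) => ?_)
    change orderedMonomial x m * z ∈ orderedSpan R w x e
    rcases eq_or_ne m 0 with rfl | hm0
    · rw [orderedMonomial_zero, one_mul]
      exact orderedSpan_mono (by omega) hz
    obtain ⟨i, m', rfl, hi⟩ := exists_single_add_of_ne_zero hm0
    have hwi := hw i
    have hweight : weight w (single i 1 + m') = w i + weight w m' := by simp [weight_single]
    have hm'z : orderedMonomial x m' * z ∈ orderedSpan R w x (weight w m' + b) :=
      hmul _ _ (by omega)
        (Submodule.mul_mem_mul (orderedMonomial_mem_orderedSpan le_rfl) hz)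
    rw [orderedMonomial_single_add x hi, mul_assoc]
    exact mul_mem_of_mul_orderedMonomial_mem
      (fun k hk => mul_orderedMonomial_mem_orderedSpan hw hx hmul i k (by omega)) hm'z

theorem exists_mem_orderedSpan [WellFoundedLT σ] (hw : ∀ i, 0 < w i)
    (hx : ∀ i j, i < j → ∃ c < w i + w j, ⁅x j, x i⁆ ∈ orderedSpan R w x c)
    (hgen : Algebra.adjoin R (Set.range x) = ⊤) (a : B) : ∃ d, a ∈ orderedSpan R w x d := by
  induction (hgen ▸ Algebra.mem_top : a ∈ Algebra.adjoin R (Set.range x)) using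
    Algebra.adjoin_induction with
  | mem a ha =>
    obtain ⟨i, rfl⟩ := ha
    exact ⟨w i, mem_orderedSpan_self i⟩
  | algebraMap r =>
    rw [Algebra.algebraMap_eq_smul_one]
    exact ⟨0, Submodule.smul_mem _ r one_mem_orderedSpan⟩
  | add a b _ _ iha ihb =>
    obtain ⟨d, hd⟩ := iha
    obtain ⟨e, he⟩ := ihb
    exact ⟨max d e, add_mem (orderedSpan_mono (le_max_left d e) hd)
      (orderedSpan_mono (le_max_right d e) he)⟩
  | mul a b _ _ iha ihb =>
    obtain ⟨d, hd⟩ := iha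
    obtain ⟨e, he⟩ := ihb
    exact ⟨d + e, orderedSpan_mul_le hw hx d e (Submodule.mul_mem_mul hd he)⟩

end OrderedSpan

section OrderedEval

variable {σ R B C : Type*} [LinearOrder σ] [CommRing R] [Ring B] [Algebra R B] [Ring C]
  [Algebra R C]

variable (R) in
/-- The linear map from polynomials to a noncommutative algebra that sends each monomial to the
corresponding ordered monomial in `x`. -/
noncomputable def orderedEval (x : σ → B) : MvPolynomial σ R →ₗ[R] B :=
  (basisMonomials σ R).constr R (orderedMonomial x)

theorem orderedEval_monomial (x : σ → B) (m : σ →₀ ℕ) (c : R) :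
    orderedEval R x (monomial m c) = c • orderedMonomial x m := by
  have h : monomial m c = c • basisMonomials σ R m := by simp [smul_monomial]
  rw [h, map_smul, orderedEval, Module.Basis.constr_basis]

theorem comp_orderedEval (f : B →ₐ[R] C) (x : σ → B) :
    f.toLinearMap ∘ₗ orderedEval R x = orderedEval R (f ∘ x) :=
  (basisMonomials σ R).ext fun m => by simp [orderedEval_monomial, map_orderedMonomial]

theorem orderedEval_mem_orderedSpan {w : σ → ℕ} {d : ℕ} (x : σ → B) {f : MvPolynomial σ R}
    (hf : ∀ m ∈ f.support, weight w m ≤ d) : orderedEval R x f ∈ orderedSpan R w x d := by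
  rw [f.as_sum, map_sum]
  refine sum_mem fun m hm => ?_
  rw [orderedEval_monomial]
  exact Submodule.smul_mem _ _ (orderedMonomial_mem_orderedSpan (hf m hm))

theorem orderedSpan_le_range_orderedEval (w : σ → ℕ) (x : σ → B) (d : ℕ) :
    orderedSpan R w x d ≤ LinearMap.range (orderedEval R x) := by
  refine Submodule.span_le.2 ?_
  rintro _ ⟨m, -, rfl⟩
  exact ⟨monomial m 1, by rw [orderedEval_monomial, one_smul]⟩

theorem orderedEval_surjective [WellFoundedLT σ] {w : σ → ℕ} {x : σ → B} (hw : ∀ i, 0 < w i)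
    (hx : ∀ i j, i < j → ∃ c < w i + w j, ⁅x j, x i⁆ ∈ orderedSpan R w x c)
    (hgen : Algebra.adjoin R (Set.range x) = ⊤) : Function.Surjective (orderedEval R x) := by
  intro a
  obtain ⟨d, hd⟩ := exists_mem_orderedSpan hw hx hgen a
  exact orderedSpan_le_range_orderedEval w x d hd

end OrderedEval

section NormalForm

variable {R B : Type*} [CommRing R] [Ring B] [Algebra R B] {x : Fin 3 → B}

theorem X_pow_mul_X_pow_mul_X_pow (i j k : ℕ) :
    (X 0 ^ i * X 1 ^ j * X 2 ^ k : MvPolynomial (Fin 3) R)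
      = monomial (single 0 i + single 1 j + single 2 k) 1 := by
  simp [X_pow_eq_monomial, monomial_mul]

theorem orderedEval_aeval_X_mul (x : Fin 3 → B) (p : Polynomial R) (j k : ℕ) :
    orderedEval R x (Polynomial.aeval (X 0) p * X 1 ^ j * X 2 ^ k)
      = Polynomial.aeval (x 0) p * x 1 ^ j * x 2 ^ k := by
  induction p using Polynomial.induction_on' with
  | add p q hp hq => simp only [map_add, add_mul, hp, hq]
  | monomial i c =>
    simp only [Polynomial.aeval_monomial, ← Algebra.smul_def, smul_mul_assoc, map_smul,
      X_pow_mul_X_pow_mul_X_pow, orderedEval_monomial, orderedMonomial_fin_three]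
    simp

theorem coeff_aeval_X_mul (p : Polynomial R) (i j k j' k' : ℕ) :
    coeff (single 0 i + single 1 j' + single 2 k')
        (Polynomial.aeval (X 0) p * X 1 ^ j * X 2 ^ k : MvPolynomial (Fin 3) R)
      = if j = j' ∧ k = k' then p.coeff i else 0 := by
  induction p using Polynomial.induction_on' with
  | add p q hp hq =>
    simp only [map_add, add_mul, coeff_add, hp, hq, Polynomial.coeff_add]
    split_ifs <;> simp
  | monomial l c =>
    simp only [Polynomial.aeval_monomial, ← Algebra.smul_def, smul_mul_assoc, coeff_smul,
      X_pow_mul_X_pow_mul_X_pow, coeff_monomial, Polynomial.coeff_monomial]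
    have hexp : (single 0 l + single 1 j + single 2 k : Fin 3 →₀ ℕ)
        = single 0 i + single 1 j' + single 2 k' ↔ l = i ∧ j = j' ∧ k = k' := by
      simp [Finsupp.ext_iff, Fin.forall_fin_succ]
    simp only [hexp, smul_eq_mul]
    split_ifs <;> simp_all

theorem eq_zero_of_aeval_add_eq_zero (hx : Function.Injective (orderedEval R x))
    {p₀ p₁ p₂ p₃ : Polynomial R}
    (h : Polynomial.aeval (x 0) p₀ + Polynomial.aeval (x 0) p₁ * x 1
      + Polynomial.aeval (x 0) p₂ * x 2 + Polynomial.aeval (x 0) p₃ * x 1 ^ 2 = 0) :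
    p₀ = 0 ∧ p₁ = 0 ∧ p₂ = 0 ∧ p₃ = 0 := by
  let q (p : Polynomial R) (j k : ℕ) : MvPolynomial (Fin 3) R :=
    Polynomial.aeval (X 0) p * X 1 ^ j * X 2 ^ k
  have hq : q p₀ 0 0 + q p₁ 1 0 + q p₂ 0 1 + q p₃ 2 0 = 0 := by
    refine (map_eq_zero_iff _ hx).1 ?_
    simp only [q, map_add, orderedEval_aeval_X_mul]
    simpa using h
  have hcoeff (i j k : ℕ) := congrArg (coeff (single 0 i + single 1 j + single 2 k)) hq
  simp only [q, coeff_add, coeff_aeval_X_mul, coeff_zero] at hcoeff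
  refine ⟨?_, ?_, ?_, ?_⟩ <;> ext i
  · simpa using hcoeff i 0 0
  · simpa using hcoeff i 1 0
  · simpa using hcoeff i 0 1
  · simpa using hcoeff i 2 0

theorem weight_typeDWeight (n : ℕ) (m : Fin 3 →₀ ℕ) :
    weight (typeDWeight n) m = 4 * m 0 + (2 * n - 2) * m 1 + 2 * n * m 2 := by
  rw [weight_apply, sum_fintype _ _ (by simp)]
  simp [Fin.sum_univ_three, typeDWeight]
  ring

theorem aeval_mul_mem_orderedSpan {n d : ℕ} (x : Fin 3 → B) (p : Polynomial R) (j k : ℕ)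
    (hd : 4 * p.natDegree + (2 * n - 2) * j + 2 * n * k ≤ d) :
    Polynomial.aeval (x 0) p * x 1 ^ j * x 2 ^ k ∈ orderedSpan R (typeDWeight n) x d := by
  simp only [Polynomial.aeval_eq_sum_range, Finset.sum_mul, smul_mul_assoc]
  refine sum_mem fun i hi => Submodule.smul_mem _ _ ?_
  have hi' : i ≤ p.natDegree := Finset.mem_range_succ_iff.1 hi
  have hx : orderedMonomial x (single 0 i + single 1 j + single 2 k)
      = x 0 ^ i * x 1 ^ j * x 2 ^ k := by simp [orderedMonomial_fin_three]
  rw [← hx]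
  exact orderedMonomial_mem_orderedSpan (by simp [weight_typeDWeight]; omega)

theorem typeDWeight_pos {n : ℕ} (hn : 2 ≤ n) (i : Fin 3) : 0 < typeDWeight n i := by
  fin_cases i <;> simp [typeDWeight] <;> omega

theorem weight_typeDWeight_lt_cases {n : ℕ} {m : Fin 3 →₀ ℕ}
    (hm : weight (typeDWeight n) m < 4 * n - 4) :
    (m 1 = 0 ∧ m 2 = 0) ∨ (m 1 = 1 ∧ m 2 = 0) ∨ (m 1 = 0 ∧ m 2 = 1) := by
  rw [weight_typeDWeight] at hm
  have h1 : (2 * n - 2) * (m 1 + m 2) < (2 * n - 2) * 2 := by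
    have : (2 * n - 2) * m 2 ≤ 2 * n * m 2 := Nat.mul_le_mul_right _ (Nat.sub_le _ _)
    rw [mul_add]
    omega
  have := lt_of_mul_lt_mul_left h1 (Nat.zero_le _)
  omega

/-- Below the degree `4 n - 4` of `x 1 ^ 2`, ordered monomials are at most linear in `x 1` and
`x 2`; the lower bound on `d` makes the degree estimates hold when `p₁` or `p₂` vanishes. -/
theorem exists_eq_of_mem_orderedSpan {n d : ℕ} (hd : 2 * n ≤ d) (hd' : d < 4 * n - 4) {a : B}
    (ha : a ∈ orderedSpan R (typeDWeight n) x d) :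
    ∃ p₀ p₁ p₂ : Polynomial R, 4 * p₀.natDegree ≤ d ∧ 4 * p₁.natDegree + (2 * n - 2) ≤ d ∧
      4 * p₂.natDegree + 2 * n ≤ d ∧
      a = Polynomial.aeval (x 0) p₀ + Polynomial.aeval (x 0) p₁ * x 1
        + Polynomial.aeval (x 0) p₂ * x 2 := by
  induction ha using Submodule.span_induction with
  | mem a ha =>
    obtain ⟨m, hm : weight (typeDWeight n) m ≤ d, rfl⟩ := ha
    have hcases := weight_typeDWeight_lt_cases (hm.trans_lt hd')
    have hX := Polynomial.natDegree_X_pow_le (R := R) (m 0)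
    rw [weight_typeDWeight] at hm
    rw [orderedMonomial_fin_three]
    obtain ⟨h1, h2⟩ | ⟨h1, h2⟩ | ⟨h1, h2⟩ := hcases <;> simp only [h1, h2] at hm ⊢
    · exact ⟨Polynomial.X ^ m 0, 0, 0, by omega, by simp; omega, by simp; omega, by simp⟩
    · exact ⟨0, Polynomial.X ^ m 0, 0, by simp, by omega, by simp; omega, by simp⟩
    · exact ⟨0, 0, Polynomial.X ^ m 0, by simp, by simp; omega, by omega, by simp⟩
  | zero => exact ⟨0, 0, 0, by simp, by simp; omega, by simp; omega, by simp⟩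
  | add a b _ _ ha hb =>
    obtain ⟨p₀, p₁, p₂, h₀, h₁, h₂, rfl⟩ := ha
    obtain ⟨q₀, q₁, q₂, k₀, k₁, k₂, rfl⟩ := hb
    have hadd₀ := Polynomial.natDegree_add_le p₀ q₀
    have hadd₁ := Polynomial.natDegree_add_le p₁ q₁
    have hadd₂ := Polynomial.natDegree_add_le p₂ q₂
    refine ⟨p₀ + q₀, p₁ + q₁, p₂ + q₂, by omega, by omega, by omega, ?_⟩
    simp only [map_add, add_mul]
    abel
  | smul c a _ ha =>
    obtain ⟨p₀, p₁, p₂, h₀, h₁, h₂, rfl⟩ := ha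
    have hsmul₀ := Polynomial.natDegree_smul_le c p₀
    have hsmul₁ := Polynomial.natDegree_smul_le c p₁
    have hsmul₂ := Polynomial.natDegree_smul_le c p₂
    refine ⟨c • p₀, c • p₁, c • p₂, by omega, by omega, by omega, ?_⟩
    simp only [smul_add, map_smul, smul_mul_assoc]

end NormalForm

section Jacobi

variable {R B : Type*} [CommRing R] [Ring B] [Algebra R B] {u v w : B}

theorem commute_aeval_self (u : B) (p : Polynomial R) : Commute u (Polynomial.aeval u p) := by
  simpa using (Polynomial.commute_X p).map (Polynomial.aeval u)

/-- Completing the square in `[u, w]`: the shifts absorb the terms in `v` and in positive powers of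
`u`. -/
theorem lie_shift_eq {a b γ : R} {q s : Polynomial R}
    (hq : q = (2 : R) • ((Polynomial.X - Polynomial.C b) * s) + Polynomial.C γ)
    (huw : ⁅u, w⁆ = -2 * (u * v) + a • w + (2 * b) • v + Polynomial.aeval u q) :
    ⁅u - algebraMap R B b, w⁆ = -2 * ((u - algebraMap R B b) * (v - Polynomial.aeval u s))
      + a • w + algebraMap R B γ := by
  have hlie : ⁅u - algebraMap R B b, w⁆ = ⁅u, w⁆ := by
    simp only [Ring.lie_def, sub_mul, mul_sub, Algebra.commutes]
    abel
  rw [hlie, huw, hq]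
  simp only [map_add, map_sub, map_mul, Polynomial.aeval_X, Polynomial.aeval_C, two_smul, two_mul,
    add_smul, Algebra.smul_def b v, sub_mul, mul_sub, neg_mul]
  abel

theorem lie_shift_shift_eq (b : R) (s : Polynomial R) :
    ⁅u - algebraMap R B b, v - Polynomial.aeval u s⁆ = ⁅u, v⁆ := by
  have hs := (commute_aeval_self u s).eq
  simp only [Ring.lie_def, sub_mul, mul_sub, Algebra.commutes, hs]
  abel

theorem lie_aeval_mul (u y : B) (p : Polynomial R) :
    ⁅u, Polynomial.aeval u p * y⁆ = Polynomial.aeval u p * ⁅u, y⁆ := by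
  rw [Ring.lie_def, Ring.lie_def, ← mul_assoc, (commute_aeval_self u p).eq, mul_sub, mul_assoc,
    mul_assoc]

theorem smul_lie_add_eq_zero_of_lie_eq {a γ : R} {P p r : Polynomial R} (huv : ⁅u, v⁆ = 2 * w)
    (huw : ⁅u, w⁆ = -2 * (u * v) + a • w + algebraMap R B γ)
    (hvw : ⁅v, w⁆ = v ^ 2 + Polynomial.aeval u P + Polynomial.aeval u p * v
      + Polynomial.aeval u r * w) :
    (2 - a) • ⁅v, w⁆ + Polynomial.aeval u p * (2 * w) + Polynomial.aeval u r * ⁅u, w⁆ = 0 := by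
  have hjacobi : ⁅u, ⁅v, w⁆⁆ = ⁅⁅u, v⁆, w⁆ + ⁅v, ⁅u, w⁆⁆ := leibniz_lie u v w
  have hleft : ⁅u, ⁅v, w⁆⁆ = 2 * (w * v + v * w) + Polynomial.aeval u p * (2 * w)
      + Polynomial.aeval u r * ⁅u, w⁆ := by
    have hsq : ⁅u, v ^ 2⁆ = ⁅u, v⁆ * v + v * ⁅u, v⁆ := by
      simp only [Ring.lie_def]; noncomm_ring
    have hP : ⁅u, Polynomial.aeval u P⁆ = 0 := (commute_aeval_self u P).lie_eq
    rw [hvw, lie_add, lie_add, lie_add, hsq, hP, lie_aeval_mul, lie_aeval_mul, huv]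
    noncomm_ring
  have hright : ⁅⁅u, v⁆, w⁆ + ⁅v, ⁅u, w⁆⁆ = 4 * (w * v) + a • ⁅v, w⁆ := by
    have hexpand : ⁅⁅u, v⁆, w⁆ + ⁅v, ⁅u, w⁆⁆ = 2 * (⁅u, v⁆ * v) + a • ⁅v, w⁆ := by
      have hww : ⁅⁅u, v⁆, w⁆ = 0 := by
        rw [huv, Ring.lie_def]; noncomm_ring
      rw [hww, huw]
      simp only [Ring.lie_def, mul_add, add_mul, Algebra.commutes, smul_sub, mul_smul_comm,
        smul_mul_assoc]
      noncomm_ring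
    rw [hexpand, huv]
    noncomm_ring
  rw [hleft, hright, ← sub_eq_zero] at hjacobi
  rw [← hjacobi, sub_smul, two_smul, Ring.lie_def v w]
  noncomm_ring

theorem aeval_add_eq_zero_of_lie_eq {a γ : R} {P p r : Polynomial R} (huv : ⁅u, v⁆ = 2 * w)
    (huw : ⁅u, w⁆ = -2 * (u * v) + a • w + algebraMap R B γ)
    (hvw : ⁅v, w⁆ = v ^ 2 + Polynomial.aeval u P + Polynomial.aeval u p * v
      + Polynomial.aeval u r * w) :
    Polynomial.aeval u ((2 - a) • P + γ • r)
      + Polynomial.aeval u ((2 - a) • p - (2 : R) • (Polynomial.X * r)) * v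
      + Polynomial.aeval u ((2 : R) • (r + p)) * w
      + Polynomial.aeval u (Polynomial.C (2 - a)) * v ^ 2 = 0 := by
  have h := smul_lie_add_eq_zero_of_lie_eq huv huw hvw
  rw [huw, hvw] at h
  rw [← h]
  simp only [map_add, map_sub, map_smul, map_mul, Polynomial.aeval_X, Polynomial.aeval_C,
    (commute_aeval_self u r).eq, sub_smul, two_smul, two_mul, neg_mul, add_mul, sub_mul, mul_add,
    mul_neg, smul_add, smul_mul_assoc, mul_smul_comm, mul_assoc, ← Algebra.commutes γ,
    ← Algebra.smul_def]
  abel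

end Jacobi

/-- The elements `x 0`, `x 1`, `x 2` of a `ℂ`-algebra satisfy the relations that define
`H(P, γ)`. -/
structure SatisfiesHRel {B : Type*} [Ring B] [Algebra ℂ B] (P : Polynomial ℂ) (γ : ℂ)
    (x : Fin 3 → B) : Prop where
  uv : ⁅x 0, x 1⁆ = 2 * x 2
  uw : ⁅x 0, x 2⁆ = -2 * (x 0 * x 1) + 2 * x 2 + algebraMap ℂ B γ
  vw : ⁅x 1, x 2⁆ = x 1 ^ 2 + Polynomial.aeval (x 0) P

theorem SatisfiesHRel.exists_lie_mem_orderedSpan {B : Type*} [Ring B] [Algebra ℂ B]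
    {P : Polynomial ℂ} {γ : ℂ} {x : Fin 3 → B} {n : ℕ} (h : SatisfiesHRel P γ x) (hn : 2 ≤ n)
    (hP : P.natDegree ≤ n - 1) (i j : Fin 3) (hij : i < j) :
    ∃ c < typeDWeight n i + typeDWeight n j, ⁅x j, x i⁆ ∈ orderedSpan ℂ (typeDWeight n) x c := by
  have hmem (p : Polynomial ℂ) (j k : ℕ) {d : ℕ} :=
    aeval_mul_mem_orderedSpan (n := n) (d := d) x p j k
  have htwo : algebraMap ℂ B 2 = 2 := map_ofNat _ 2
  simp only [← lie_skew (x j), neg_mem_iff]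
  obtain ⟨rfl, rfl⟩ | ⟨rfl, rfl⟩ | ⟨rfl, rfl⟩ :
      i = 0 ∧ j = 1 ∨ i = 0 ∧ j = 2 ∨ i = 1 ∧ j = 2 := by omega
  · refine ⟨2 * n, by simp [typeDWeight]; omega, ?_⟩
    rw [h.uv]
    simpa [htwo] using hmem (Polynomial.C 2) 0 1 (d := 2 * n) (by simp)
  · refine ⟨2 * n + 2, by simp [typeDWeight]; omega, ?_⟩
    rw [h.uw]
    have huv := hmem (Polynomial.C (-2) * Polynomial.X) 1 0 (d := 2 * n + 2)
      (by rw [Polynomial.natDegree_C_mul_X _ (by norm_num)]; omega)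
    have hw := hmem (Polynomial.C 2) 0 1 (d := 2 * n + 2) (by simp)
    have hγ := hmem (Polynomial.C γ) 0 0 (d := 2 * n + 2) (by simp)
    simpa [htwo, mul_assoc] using add_mem (add_mem huv hw) hγ
  · refine ⟨4 * n - 4, by simp [typeDWeight]; omega, ?_⟩
    rw [h.vw]
    have hv := hmem 1 2 0 (d := 4 * n - 4) (by simp; omega)
    have hP := hmem P 0 0 (d := 4 * n - 4) (by omega)
    simpa using add_mem hv hP

namespace HAlg

variable {B : Type*} [Ring B] [Algebra ℂ B] {P : Polynomial ℂ} {γ : ℂ} {x : Fin 3 → B}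

theorem satisfiesHRel_gen (P : Polynomial ℂ) (γ : ℂ) : SatisfiesHRel P γ (gen P γ) where
  uv := by
    have h := RingQuot.mkAlgHom_rel ℂ (HRel.uv (P := P) (γ := γ))
    rwa [map_sub, map_mul, map_mul, map_mul, map_ofNat] at h
  uw := by
    have h := RingQuot.mkAlgHom_rel ℂ (HRel.uw (P := P) (γ := γ))
    simp only [map_sub, map_add, map_mul, map_neg, AlgHom.commutes, map_ofNat] at h
    exact h
  vw := by
    simpa [gen, Ring.lie_def, Polynomial.aeval_algHom_apply] using
      RingQuot.mkAlgHom_rel ℂ (HRel.vw (P := P) (γ := γ))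

theorem adjoin_range_gen (P : Polynomial ℂ) (γ : ℂ) :
    Algebra.adjoin ℂ (Set.range (gen P γ)) = ⊤ := by
  have hrange : Set.range (gen P γ)
      = RingQuot.mkAlgHom ℂ (HRel P γ) '' Set.range (FreeAlgebra.ι ℂ) :=
    Set.range_comp (RingQuot.mkAlgHom ℂ (HRel P γ)) (FreeAlgebra.ι ℂ)
  rw [hrange, Algebra.adjoin_image, FreeAlgebra.adjoin_range_ι, Algebra.map_top]
  exact (AlgHom.range_eq_top _).2 (RingQuot.mkAlgHom_surjective ℂ _)

theorem orderedEval_gen_surjective {n : ℕ} (hn : 2 ≤ n) (hP : P.natDegree ≤ n - 1) :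
    Function.Surjective (orderedEval ℂ (gen P γ)) :=
  orderedEval_surjective (typeDWeight_pos hn)
    ((satisfiesHRel_gen P γ).exists_lie_mem_orderedSpan hn hP) (adjoin_range_gen P γ)

theorem filt_eq_orderedSpan (n : ℕ) (P : Polynomial ℂ) (γ : ℂ) (d : ℕ) :
    filt n P γ d = orderedSpan ℂ (typeDWeight n) (gen P γ) d := by
  rw [filt, orderedSpan]
  congr 1
  ext a
  simp only [Set.mem_ofPred_eq, Set.mem_image, orderedMonomial_fin_three, weight_typeDWeight]
  constructor
  · rintro ⟨i, j, k, hd, rfl⟩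
    exact ⟨single 0 i + single 1 j + single 2 k, by simpa using hd, by simp⟩
  · rintro ⟨m, hd, rfl⟩
    exact ⟨m 0, m 1, m 2, hd, rfl⟩

/-- The algebra homomorphism `H(P, γ) → B` that sends the generators to elements of `B` satisfying
the defining relations. -/
noncomputable def lift (h : SatisfiesHRel P γ x) : HAlg P γ →ₐ[ℂ] B :=
  RingQuot.liftAlgHom ℂ ⟨FreeAlgebra.lift ℂ x, by
    rintro _ _ (_ | _ | _)
    · simpa [Ring.lie_def, map_ofNat] using h.uv
    · simpa [Ring.lie_def, map_ofNat] using h.uw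
    · simpa [Ring.lie_def, ← Polynomial.aeval_algHom_apply] using h.vw⟩

theorem lift_comp_gen (h : SatisfiesHRel P γ x) : lift h ∘ gen P γ = x := by
  ext i
  simp [lift, gen]

theorem lift_bijective {n : ℕ} (hn : 2 ≤ n) (hP : P.natDegree ≤ n - 1) (h : SatisfiesHRel P γ x)
    (hx : Function.Bijective (orderedEval ℂ x)) : Function.Bijective (lift h) := by
  have hcomp : lift h ∘ orderedEval ℂ (gen P γ) = orderedEval ℂ x := by
    have := comp_orderedEval (lift h) (gen P γ)
    rw [lift_comp_gen] at this
    exact congrArg DFunLike.coe this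
  rw [← hcomp] at hx
  refine ⟨?_, hx.2.of_comp⟩
  exact hx.1.of_comp_right (orderedEval_gen_surjective hn hP)

end HAlg

theorem poissonBracket_typeDPoly_X_zero_X_one (n : ℕ) :
    poissonBracket (typeDPoly n) (X 0) (X 1) = 2 * X 2 := by
  simp [poissonBracket, typeDPoly, pderiv_X]

theorem poissonBracket_typeDPoly_X_zero_X_two (n : ℕ) :
    poissonBracket (typeDPoly n) (X 0) (X 2) = -2 * (X 0 * X 1) := by
  simp [poissonBracket, typeDPoly, pderiv_X]
  ring

theorem poissonBracket_typeDPoly_X_one_X_two (n : ℕ) :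
    poissonBracket (typeDPoly n) (X 1) (X 2) = X 1 ^ 2 + (n : ℂ) • X 0 ^ (n - 1) := by
  simp [poissonBracket, typeDPoly, pderiv_X, smul_eq_C_mul]
  ring

namespace NoncommDeformation

variable {n : ℕ} {A : Type*} [Ring A] [Algebra ℂ A] (D : NoncommDeformation n A)

/-- `a` lies in degree `i` of the filtration, and the isomorphism `gr A ≅ ℂ[X, Y, Z]` sends its
class in degree `i` to `f`. -/
def HasSymbol (i : ℕ) (a : A) (f : MvPolynomial (Fin 3) ℂ) : Prop :=
  ∃ h : a ∈ D.filt i, (D.grEquiv i (grClass D.filt i ⟨a, h⟩) : MvPolynomial (Fin 3) ℂ) = f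

/-- The elements `x 0`, `x 1`, `x 2` of `A` lift the variables `X`, `Y`, `Z` of the associated
graded algebra. -/
def LiftsVariables (x : Fin 3 → A) : Prop :=
  ∀ i, D.HasSymbol (typeDWeight n i) (x i) (X i)

variable {D}

theorem filt_mono {i j : ℕ} (h : i ≤ j) : D.filt i ≤ D.filt j :=
  D.isRingFiltration.mono h

theorem hasSymbol_zero_of_mem {i j : ℕ} {a : A} (ha : a ∈ D.filt j) (hj : j < i) :
    D.HasSymbol i a 0 := by
  have hclass : grClass D.filt i ⟨a, filt_mono hj.le ha⟩ = 0 :=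
    (Submodule.Quotient.mk_eq_zero _).2 (D.isRingFiltration.is_le hj ha)
  exact ⟨filt_mono hj.le ha, by simp [hclass]⟩

theorem exists_hasSymbol {i : ℕ} {f : MvPolynomial (Fin 3) ℂ}
    (hf : IsWeightedHomogeneous (typeDWeight n) f i) : ∃ a, D.HasSymbol i a f := by
  obtain ⟨a, ha⟩ := Submodule.mkQ_surjective _ ((D.grEquiv i).symm ⟨f, hf⟩)
  refine ⟨a, a.2, ?_⟩
  change (D.grEquiv i (Submodule.mkQ _ a) : MvPolynomial (Fin 3) ℂ) = f
  rw [ha, LinearEquiv.apply_symm_apply]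

namespace HasSymbol

variable {i j k : ℕ} {a b : A} {f g : MvPolynomial (Fin 3) ℂ}

theorem mem (h : D.HasSymbol i a f) : a ∈ D.filt i := h.1

theorem isWeightedHomogeneous (h : D.HasSymbol i a f) :
    IsWeightedHomogeneous (typeDWeight n) f i := by
  obtain ⟨h, rfl⟩ := h
  exact (D.grEquiv i _).2

theorem eq (hf : D.HasSymbol i a f) (hg : D.HasSymbol i a g) : f = g :=
  hf.2.symm.trans hg.2

theorem add (ha : D.HasSymbol i a f) (hb : D.HasSymbol i b g) :
    D.HasSymbol i (a + b) (f + g) := by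
  obtain ⟨ha, rfl⟩ := ha
  obtain ⟨hb, rfl⟩ := hb
  refine ⟨add_mem ha hb, ?_⟩
  rw [← Submodule.coe_add, ← map_add, ← map_add]
  rfl

theorem smul (c : ℂ) (h : D.HasSymbol i a f) : D.HasSymbol i (c • a) (c • f) := by
  obtain ⟨ha, rfl⟩ := h
  refine ⟨Submodule.smul_mem _ c ha, ?_⟩
  rw [← Submodule.coe_smul, ← map_smul, ← map_smul]
  rfl

theorem sub (ha : D.HasSymbol i a f) (hb : D.HasSymbol i b g) :
    D.HasSymbol i (a - b) (f - g) := by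
  simpa [sub_eq_add_neg] using ha.add (hb.smul (-1))

theorem sub_of_mem (ha : D.HasSymbol i a f) (hb : b ∈ D.filt j) (hj : j < i) :
    D.HasSymbol i (a - b) f := by
  simpa using ha.sub (hasSymbol_zero_of_mem hb hj)

variable (D) in
theorem zero (i : ℕ) : D.HasSymbol i 0 0 := by
  refine ⟨zero_mem _, ?_⟩
  change (D.grEquiv i (grClass D.filt i 0) : MvPolynomial (Fin 3) ℂ) = 0
  simp

theorem sum {ι : Type*} {s : Finset ι} {a : ι → A} {f : ι → MvPolynomial (Fin 3) ℂ}
    (h : ∀ x ∈ s, D.HasSymbol i (a x) (f x)) : D.HasSymbol i (∑ x ∈ s, a x) (∑ x ∈ s, f x) := by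
  induction s using Finset.cons_induction with
  | empty => exact zero D i
  | cons x s hx ih =>
    rw [Finset.forall_mem_cons] at h
    simpa only [Finset.sum_cons] using h.1.add (ih h.2)

theorem mul (ha : D.HasSymbol i a f) (hb : D.HasSymbol j b g) :
    D.HasSymbol (i + j) (a * b) (f * g) := by
  obtain ⟨ha, rfl⟩ := ha
  obtain ⟨hb, rfl⟩ := hb
  exact ⟨_, D.grEquiv_mul i j ⟨a, ha⟩ ⟨b, hb⟩⟩

theorem pow (h : D.HasSymbol i a f) (m : ℕ) : D.HasSymbol (i * m) (a ^ m) (f ^ m) := by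
  induction m with
  | zero => simpa using ⟨_, D.grEquiv_one⟩
  | succ m ih => simpa only [pow_succ, mul_add_one] using ih.mul h

theorem lie (ha : D.HasSymbol i a f) (hb : D.HasSymbol j b g) (hk : i + j = k + 2) :
    D.HasSymbol k ⁅a, b⁆ (poissonBracket (typeDPoly n) f g) := by
  obtain ⟨ha, rfl⟩ := ha
  obtain ⟨hb, rfl⟩ := hb
  exact D.grEquiv_commutator i j k hk ⟨a, ha⟩ ⟨b, hb⟩

theorem mem_filtLT (h : D.HasSymbol i a 0) : a ∈ filtLT D.filt i := by
  obtain ⟨ha, h⟩ := h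
  rw [Submodule.coe_eq_zero, LinearEquiv.map_eq_zero_iff] at h
  exact (Submodule.Quotient.mk_eq_zero ((filtLT D.filt i).submoduleOf (D.filt i))).1 h

theorem sub_mem_filtLT (ha : D.HasSymbol i a f) (hb : D.HasSymbol i b f) :
    a - b ∈ filtLT D.filt i :=
  mem_filtLT (by simpa using ha.sub hb)

theorem sub_mem_filt (ha : D.HasSymbol (i + 1) a f) (hb : D.HasSymbol (i + 1) b f) :
    a - b ∈ D.filt i :=
  (iSup₂_le fun _ hj => filt_mono (Nat.le_of_lt_succ hj) : filtLT D.filt (i + 1) ≤ D.filt i)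
    (ha.sub_mem_filtLT hb)

end HasSymbol

namespace LiftsVariables

variable {x : Fin 3 → A} {d : ℕ}

theorem hasSymbol_orderedMonomial (hx : D.LiftsVariables x) (m : Fin 3 →₀ ℕ) :
    D.HasSymbol (weight (typeDWeight n) m) (orderedMonomial x m) (monomial m 1) := by
  have h := (((hx 0).pow (m 0)).mul ((hx 1).pow (m 1))).mul ((hx 2).pow (m 2))
  rwa [weight_typeDWeight, orderedMonomial_fin_three, monomial_eq, C_1, one_mul,
    Finsupp.prod_fintype _ _ (by simp), Fin.prod_univ_three]

theorem hasSymbol_orderedEval (hx : D.LiftsVariables x) {f : MvPolynomial (Fin 3) ℂ}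
    (hf : ∀ m ∈ f.support, weight (typeDWeight n) m ≤ d) :
    D.HasSymbol d (orderedEval ℂ x f) (weightedHomogeneousComponent (typeDWeight n) d f) := by
  conv => arg 3; rw [f.as_sum]
  conv => arg 4; rw [f.as_sum]
  rw [map_sum, map_sum]
  refine HasSymbol.sum fun m hm => ?_
  have hs : D.HasSymbol (weight (typeDWeight n) m) (orderedEval ℂ x (monomial m (coeff m f)))
      (monomial m (coeff m f)) := by
    simpa [orderedEval_monomial, smul_monomial] using
      (hx.hasSymbol_orderedMonomial m).smul (coeff m f)
  rcases (hf m hm).eq_or_lt with rfl | hlt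
  · rwa [weightedHomogeneousComponent_eq_self hs.isWeightedHomogeneous]
  · rw [hs.isWeightedHomogeneous.weightedHomogeneousComponent_ne _ hlt.ne']
    exact hasSymbol_zero_of_mem hs.mem hlt

theorem filt_eq_orderedSpan (hx : D.LiftsVariables x) (d : ℕ) :
    D.filt d = orderedSpan ℂ (typeDWeight n) x d := by
  refine le_antisymm ?_ (Submodule.span_le.2 ?_)
  · induction d using Nat.strong_induction_on with
    | _ d ih =>
      intro a ha
      obtain ⟨f, hf⟩ : ∃ f, D.HasSymbol d a f := ⟨_, ha, rfl⟩
      have hweight : ∀ m ∈ f.support, weight (typeDWeight n) m ≤ d := fun m hm =>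
        (hf.isWeightedHomogeneous (MvPolynomial.mem_support_iff.1 hm)).le
      have heval := hx.hasSymbol_orderedEval hweight
      rw [weightedHomogeneousComponent_eq_self hf.isWeightedHomogeneous] at heval
      have hlower : filtLT D.filt d ≤ orderedSpan ℂ (typeDWeight n) x d :=
        iSup₂_le fun c hc => (ih c hc).trans (orderedSpan_mono hc.le)
      simpa only [sub_add_cancel] using add_mem (hlower (hf.sub_mem_filtLT heval))
        (orderedEval_mem_orderedSpan x hweight)
  · rintro _ ⟨m, hm, rfl⟩
    exact filt_mono hm (hx.hasSymbol_orderedMonomial m).mem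

theorem orderedEval_injective (hx : D.LiftsVariables x) :
    Function.Injective (orderedEval ℂ x) := by
  rw [← LinearMap.ker_eq_bot, LinearMap.ker_eq_bot']
  intro f hf
  by_contra hne
  obtain ⟨m, hm, hmax⟩ :=
    f.support.exists_max_image (weight (typeDWeight n)) (support_nonempty.2 hne)
  have htop := hx.hasSymbol_orderedEval hmax
  rw [hf] at htop
  have hcoeff := congrArg (coeff m) (htop.eq (HasSymbol.zero D _))
  classical
  rw [coeff_weightedHomogeneousComponent, if_pos rfl, coeff_zero] at hcoeff
  exact MvPolynomial.mem_support_iff.1 hm hcoeff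

theorem orderedEval_surjective (hx : D.LiftsVariables x) :
    Function.Surjective (orderedEval ℂ x) := by
  intro a
  obtain ⟨d, hd⟩ := D.exhaustive a
  rw [hx.filt_eq_orderedSpan] at hd
  exact orderedSpan_le_range_orderedEval _ x d hd

theorem aeval_mem_filt (hx : D.LiftsVariables x) {p : Polynomial ℂ} (hp : 4 * p.natDegree ≤ d) :
    Polynomial.aeval (x 0) p ∈ D.filt d := by
  rw [hx.filt_eq_orderedSpan]
  simpa using aeval_mul_mem_orderedSpan x p 0 0 (n := n) (by omega)

theorem exists_lie_zero_two_eq (hn : 3 ≤ n) (hx : D.LiftsVariables x) :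
    ∃ (a b : ℂ) (q : Polynomial ℂ), 4 * q.natDegree ≤ 2 * n + 1 ∧
      ⁅x 0, x 2⁆ = -2 * (x 0 * x 1) + a • x 2 + b • x 1 + Polynomial.aeval (x 0) q := by
  have hlie : D.HasSymbol (2 * n + 1 + 1) ⁅x 0, x 2⁆ (-2 * (X 0 * X 1)) := by
    rw [← poissonBracket_typeDPoly_X_zero_X_two n]
    exact (hx 0).lie (hx 2) (by simp [typeDWeight]; omega)
  have hmul : D.HasSymbol (2 * n + 1 + 1) (-2 * (x 0 * x 1)) (-2 * (X 0 * X 1)) := by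
    have h := ((hx 0).mul (hx 1)).smul (-2)
    rwa [neg_smul, two_smul, neg_smul, two_smul, ← two_mul, ← two_mul, ← neg_mul, ← neg_mul,
      show typeDWeight n 0 + typeDWeight n 1 = 2 * n + 1 + 1 by simp [typeDWeight]; omega] at h
  have hmem := hlie.sub_mem_filt hmul
  rw [hx.filt_eq_orderedSpan] at hmem
  obtain ⟨q, p₁, p₂, hq, hp₁, hp₂, heq⟩ :=
    exists_eq_of_mem_orderedSpan (by omega) (by omega) hmem
  rw [Polynomial.eq_C_of_natDegree_eq_zero (show p₁.natDegree = 0 by omega),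
    Polynomial.eq_C_of_natDegree_eq_zero (show p₂.natDegree = 0 by omega), Polynomial.aeval_C,
    Polynomial.aeval_C, ← Algebra.smul_def, ← Algebra.smul_def, sub_eq_iff_eq_add] at heq
  refine ⟨p₂.coeff 0, p₁.coeff 0, q, hq, heq.trans ?_⟩
  abel

theorem exists_lie_one_two_eq (hn : 3 ≤ n) (hx : D.LiftsVariables x) :
    ∃ P p r : Polynomial ℂ, P.natDegree = n - 1 ∧ P.leadingCoeff = n ∧
      ⁅x 1, x 2⁆ = x 1 ^ 2 + Polynomial.aeval (x 0) P + Polynomial.aeval (x 0) p * x 1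
        + Polynomial.aeval (x 0) r * x 2 := by
  obtain ⟨d, hd⟩ : ∃ d, d + 1 = 4 * n - 4 := ⟨4 * n - 5, by omega⟩
  have hlie : D.HasSymbol (d + 1) ⁅x 1, x 2⁆ (X 1 ^ 2 + (n : ℂ) • X 0 ^ (n - 1)) := by
    rw [← poissonBracket_typeDPoly_X_one_X_two n]
    exact (hx 1).lie (hx 2) (by simp [typeDWeight]; omega)
  have hsum : D.HasSymbol (d + 1) (x 1 ^ 2 + (n : ℂ) • x 0 ^ (n - 1))
      (X 1 ^ 2 + (n : ℂ) • X 0 ^ (n - 1)) := by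
    have h₁ := (hx 1).pow 2
    have h₀ := ((hx 0).pow (n - 1)).smul (n : ℂ)
    rw [show typeDWeight n 1 * 2 = d + 1 by simp [typeDWeight]; omega] at h₁
    rw [show typeDWeight n 0 * (n - 1) = d + 1 by simp [typeDWeight]; omega] at h₀
    exact h₁.add h₀
  have hmem := hlie.sub_mem_filt hsum
  rw [hx.filt_eq_orderedSpan] at hmem
  obtain ⟨Q, p, r, hQ, -, -, heq⟩ := exists_eq_of_mem_orderedSpan (by omega) (by omega) hmem
  have hlead : (Polynomial.C (n : ℂ) * Polynomial.X ^ (n - 1)).natDegree = n - 1 :=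
    Polynomial.natDegree_C_mul_X_pow _ _ (Nat.cast_ne_zero.2 (by omega))
  have hlt : Q.natDegree < (Polynomial.C (n : ℂ) * Polynomial.X ^ (n - 1)).natDegree := by omega
  refine ⟨Polynomial.C (n : ℂ) * Polynomial.X ^ (n - 1) + Q, p, r, ?_, ?_, ?_⟩
  · rw [Polynomial.natDegree_add_eq_left_of_natDegree_lt hlt, hlead]
  · rw [Polynomial.leadingCoeff_add_of_degree_lt' (Polynomial.degree_lt_degree hlt),
      Polynomial.leadingCoeff_C_mul_X_pow]
  · rw [sub_eq_iff_eq_add.1 heq, map_add, map_mul, Polynomial.aeval_C, ← Algebra.smul_def,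
      map_pow, Polynomial.aeval_X]
    abel

end LiftsVariables

theorem liftsVariables_of_lie_eq (hn : 2 ≤ n) {u v w : A} (hu : D.HasSymbol 4 u (X 0))
    (hv : D.HasSymbol (2 * n - 2) v (X 1)) (huv : ⁅u, v⁆ = 2 * w) :
    D.LiftsVariables ![u, v, w] := by
  have hw : D.HasSymbol (2 * n) w (X 2) := by
    have h := (hu.lie hv (k := 2 * n) (by omega)).smul (2⁻¹ : ℂ)
    rw [poissonBracket_typeDPoly_X_zero_X_one, huv, two_mul w, two_mul (X 2),
      ← two_smul ℂ w, ← two_smul ℂ (X 2)] at h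
    simpa only [inv_smul_smul₀ (two_ne_zero : (2 : ℂ) ≠ 0)] using h
  intro i
  fin_cases i
  exacts [hu, hv, hw]

theorem exists_liftsVariables (hn : 2 ≤ n) (D : NoncommDeformation n A) :
    ∃ x : Fin 3 → A, D.LiftsVariables x ∧ ⁅x 0, x 1⁆ = 2 * x 2 := by
  obtain ⟨u, hu⟩ := D.exists_hasSymbol (isWeightedHomogeneous_X ℂ (typeDWeight n) 0)
  obtain ⟨v, hv⟩ := D.exists_hasSymbol (isWeightedHomogeneous_X ℂ (typeDWeight n) 1)
  have huv : ⁅u, v⁆ = 2 * ((2⁻¹ : ℂ) • ⁅u, v⁆) := by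
    rw [two_mul, ← two_smul ℂ, smul_inv_smul₀ two_ne_zero]
  exact ⟨_, liftsVariables_of_lie_eq hn hu hv huv, huv⟩

theorem exists_liftsVariables_lie_zero_two_eq (hn : 3 ≤ n) (D : NoncommDeformation n A) :
    ∃ (x : Fin 3 → A) (a γ : ℂ), D.LiftsVariables x ∧ ⁅x 0, x 1⁆ = 2 * x 2 ∧
      ⁅x 0, x 2⁆ = -2 * (x 0 * x 1) + a • x 2 + algebraMap ℂ A γ := by
  obtain ⟨x, hx, huv⟩ := exists_liftsVariables (by omega) D
  obtain ⟨a, b, q, hq, huw⟩ := hx.exists_lie_zero_two_eq hn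
  let s : Polynomial ℂ := (2⁻¹ : ℂ) • (q /ₘ (Polynomial.X - Polynomial.C (b / 2)))
  have hqs : q = (2 : ℂ) • ((Polynomial.X - Polynomial.C (b / 2)) * s)
      + Polynomial.C (q.eval (b / 2)) := by
    conv_lhs => rw [← Polynomial.modByMonic_add_div q (Polynomial.X - Polynomial.C (b / 2)),
      Polynomial.modByMonic_X_sub_C_eq_C_eval, add_comm]
    rw [mul_smul_comm, smul_inv_smul₀ two_ne_zero]
  have hs : s.natDegree ≤ q.natDegree - 1 := by
    refine (Polynomial.natDegree_smul_le _ _).trans ?_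
    rw [Polynomial.natDegree_divByMonic _ (Polynomial.monic_X_sub_C _),
      Polynomial.natDegree_X_sub_C]
  have hb : algebraMap ℂ A (b / 2) ∈ D.filt 0 := by
    simpa using hx.aeval_mem_filt (p := Polynomial.C (b / 2)) (d := 0) (by simp)
  have hu : D.HasSymbol 4 (x 0 - algebraMap ℂ A (b / 2)) (X 0) :=
    (hx 0).sub_of_mem hb (by simp [typeDWeight])
  have hv : D.HasSymbol (2 * n - 2) (x 1 - Polynomial.aeval (x 0) s) (X 1) :=
    (hx 1).sub_of_mem (hx.aeval_mem_filt le_rfl) (by simp [typeDWeight]; omega)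
  have huv' := (lie_shift_shift_eq (u := x 0) (v := x 1) (b / 2) s).trans huv
  refine ⟨_, a, q.eval (b / 2), liftsVariables_of_lie_eq (by omega) hu hv huv', huv', ?_⟩
  exact lie_shift_eq hqs (by rwa [mul_div_cancel₀ b two_ne_zero])

theorem exists_liftsVariables_satisfiesHRel (hn : 3 ≤ n) (D : NoncommDeformation n A) :
    ∃ (x : Fin 3 → A) (P : Polynomial ℂ) (γ : ℂ), D.LiftsVariables x ∧ P.natDegree = n - 1 ∧
      P.leadingCoeff = n ∧ SatisfiesHRel P γ x := by
  obtain ⟨x, a, γ, hx, huv, huw⟩ := exists_liftsVariables_lie_zero_two_eq hn D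
  obtain ⟨P, p, r, hdeg, hlead, hvw⟩ := hx.exists_lie_one_two_eq hn
  obtain ⟨-, hp, hr, ha⟩ := eq_zero_of_aeval_add_eq_zero hx.orderedEval_injective
    (aeval_add_eq_zero_of_lie_eq huv huw hvw)
  obtain rfl : a = 2 := (sub_eq_zero.1 (Polynomial.C_eq_zero.1 ha)).symm
  obtain rfl : r = 0 := by simpa using hp
  obtain rfl : p = 0 := by simpa using hr
  refine ⟨x, P, γ, hx, hdeg, hlead, huv, ?_, ?_⟩
  · rw [huw, two_smul, two_mul (x 2)]
  · simpa using hvw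

end NoncommDeformation

theorem mainTheorem8 (n : ℕ) (hn : 3 ≤ n) (A : Type*) [Ring A] [Algebra ℂ A]
    (D : NoncommDeformation n A) :
    ∃ (P : Polynomial ℂ) (γ : ℂ),
      P.natDegree = n - 1 ∧ P.leadingCoeff = (n : ℂ) ∧
        ∃ e : A ≃ₐ[ℂ] HAlg P γ, ∀ d : ℕ,
          (D.filt d).map (e : A →ₗ[ℂ] HAlg P γ) = HAlg.filt n P γ d := by
  obtain ⟨x, P, γ, hx, hdeg, hlead, hrel⟩ := D.exists_liftsVariables_satisfiesHRel hn
  have hbij : Function.Bijective (HAlg.lift hrel) :=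
    HAlg.lift_bijective (by omega) hdeg.le hrel
      ⟨hx.orderedEval_injective, hx.orderedEval_surjective⟩
  let e : HAlg P γ ≃ₐ[ℂ] A := AlgEquiv.ofBijective (HAlg.lift hrel) hbij
  have he : e.symm ∘ x = HAlg.gen P γ :=
    funext fun i => e.symm_apply_eq.2 (congrFun (HAlg.lift_comp_gen hrel) i).symm
  refine ⟨P, γ, hdeg, hlead, e.symm, fun d => ?_⟩
  rw [hx.filt_eq_orderedSpan, HAlg.filt_eq_orderedSpan, ← he]
  exact map_orderedSpan (e.symm : A →ₐ[ℂ] HAlg P γ) (typeDWeight n) x d
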